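/- Let $d,M\ge 0$ be integers, let $\widehat D=\{r\in\mathbb R^d:\ r_i\ge -1,\ r_1+\dots+r_d\le 2-d\}$ be the reference simplex, with barycentric coordinates $\lambda_0=\tfrac12\bigl(2-d-\sum_i r_i\bigr)$ and $\lambda_i=\tfrac12(1+r_i)$ for $1\le i\le d$. For $K\ge0$ let $P^K(\widehat D)$ be the space of polynomials of total degree at most $K$, and for a multi-index $\alpha\in\mathbb Z_{\ge0}^{d+1}$ with $|\alpha|=K$ let $B^K_\alpha=\frac{K!}{\alpha_0!\cdots\alpha_d!}\lambda_0^{\alpha_0}\cdots\lambda_d^{\alpha_d}$ be the Bernstein polynomials of degree $K$. Let $E^{K+1}_K$ be the one-degree elevation matrix, with entries $(E^{K+1}_K)_{\alpha+e_j,\alpha}=\frac{\alpha_j+1}{K+1}$ for $|\alpha|=K$, $0\le j\le d$, and all other entries $0$ (so that $B^K_\alpha=\sum_j\frac{\alpha_j+1}{K+1}B^{K+1}_{\alpha+e_j}$), and for $A\le B$ let $E^B_A=E^B_{B-1}E^{B-1}_{B-2}\cdots E^{A+1}_A$, with $E^A_A=I$. Let $G^{A,B}$ be the matrix with entries $\int_{\widehat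 D}B^A_\alpha B^B_\beta$, and put $P^{N+M}_N=(G^{N,N})^{-1}G^{N,N+M}$. There is a constant $C$, depending only on $d$ and $M$, such that the following holds for every integer $N\ge0$. 1. $P^{N+M}_N$ is the Bernstein-coefficient matrix of the $L^2(\widehat D)$-orthogonal projection from $P^{N+M}(\widehat D)$ onto $P^N(\widehat D)$: it is the one and only matrix that maps the coefficients in $(B^{N+M}_\gamma)_{|\gamma|=N+M}$ of each $p\in P^{N+M}(\widehat D)$ to coefficients in $(B^N_\alpha)_{|\alpha|=N}$ of the $L^2$ projection of $p$ onto $P^N(\widehat D)$. 2. There exist real scalars $c_0,\dots,c_N$ such that $$P^{N+M}_N=\sum_{j=0}^N c_j\,E^N_{N-j}\bigl(E^N_{N-j}\bigr)^T\bigl(E^{N+M}_N\bigr)^T ,$$ and, with the same scalars, the telescoping form $$P^{N+M}_N=\Bigl(c_0I+E^N_{N-1}\bigl(c_1I+E^{N-1}_{N-2}(c_2I+\cdots)(E^{N-1}_{N-2})^T\bigr)(E^N_{N-1})^T\Bigr)\bigl(E^{N+1}_N\bigr)^T\cdots\bigl(E^{N+M}_{N+M-1}\bigr)^T$$ holds.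 Moreover, the algorithm that evaluates this telescoping form on a vector $v$ by entrywise multiply-accumulate instructions (a downward sweep that applies the sparse matrices $(E^{K+1}_K)^T$ for $K=N+M-1,\dots,0$ to give vectors $p_K$, with $p_{N+M}=v$, $p_K=(E^{K+1}_K)^Tp_{K+1}$, followed by an upward sweep $q_0=c_Np_0$, $q_K=c_{N-K}p_K+E^K_{K-1}q_{K-1}$ for $1\le K\le N$) returns $q_N=P^{N+M}_Nv$ for every $v$, and if $N\ge1$ it uses at most $C\,N^{d+1}$ additions and multiplications, the scalars $c_j$ and the entries of the one-degree elevation matrices being precomputed. -/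

import Mathlib

noncomputable section

/-- Barycentric multi-indices `α = (α₀, …, α_d)` of order `|α| = N`. -/
abbrev MultiIndex (d N : ℕ) : Type := {α : Fin (d + 1) → ℕ // ∑ i, α i = N}

instance MultiIndex.instFintype (d N : ℕ) : Fintype (MultiIndex d N) :=
  Fintype.subtype (Finset.Nat.antidiagonalTuple (d + 1) N)
    (fun _ => Finset.Nat.mem_antidiagonalTuple)

/-- The reference simplex `{r ≥ -1, r₁ + ⋯ + r_d ≤ 2 - d}` with vertices
`(-1, …, -1)` and `(-1, …, 1, …, -1)`. -/
def refSimplex (d : ℕ) : Set (Fin d → ℝ) :=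
  {x | (∀ i, -1 ≤ x i) ∧ ∑ i, x i ≤ 2 - (d : ℝ)}

/-- The barycentric coordinates of the reference simplex, as polynomials:
`λ₀ = (2 - d - ∑ rᵢ) / 2` and `λᵢ = (1 + rᵢ) / 2` for `i = 1, …, d`. -/
def baryCoord (d : ℕ) : Fin (d + 1) → MvPolynomial (Fin d) ℝ :=
  Fin.cons
    (MvPolynomial.C (1 / 2) *
      (MvPolynomial.C (2 - (d : ℝ)) - ∑ i : Fin d, MvPolynomial.X i))
    (fun i => MvPolynomial.C (1 / 2) * (1 + MvPolynomial.X i))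

/-- The Bernstein polynomial `B^N_α = N! / (α₀! ⋯ α_d!) λ₀^{α₀} ⋯ λ_d^{α_d}`. -/
def bernsteinPoly (d N : ℕ) (α : MultiIndex d N) : MvPolynomial (Fin d) ℝ :=
  MvPolynomial.C (Nat.multinomial Finset.univ α.1 : ℝ) * ∏ i, baryCoord d i ^ α.1 i

/-- The polynomial `∑_{|α| = N} v_α B^N_α` with Bernstein coefficients `v`. -/
def ofBernstein (d N : ℕ) (v : MultiIndex d N → ℝ) : MvPolynomial (Fin d) ℝ :=
  ∑ α, MvPolynomial.C (v α) * bernsteinPoly d N α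

/-- The `L²` inner product of two polynomials on the reference simplex. -/
def l2Inner (d : ℕ) (p q : MvPolynomial (Fin d) ℝ) : ℝ :=
  ∫ x in refSimplex d, MvPolynomial.eval x p * MvPolynomial.eval x q

/-- `q` is the `L²` projection of `p` onto the polynomials of total degree at most `N`. -/
def IsL2Projection (d N : ℕ) (p q : MvPolynomial (Fin d) ℝ) : Prop :=
  q.totalDegree ≤ N ∧
    ∀ w : MvPolynomial (Fin d) ℝ, w.totalDegree ≤ N → l2Inner d q w = l2Inner d p w

/-- `Q` is a matrix, with respect to the Bernstein bases, of the `L²` projection from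
polynomials of degree `N + M` to polynomials of degree `N`. -/
def IsL2ProjectionMatrix (d N M : ℕ)
    (Q : Matrix (MultiIndex d N) (MultiIndex d (N + M)) ℝ) : Prop :=
  ∀ v : MultiIndex d (N + M) → ℝ,
    IsL2Projection d N (ofBernstein d (N + M) v) (ofBernstein d N (Q.mulVec v))

/-- The matrix of `L²` inner products `(B^A_α, B^B_β)`; for `A = B` the Bernstein mass matrix. -/
def bernsteinGram (d A B : ℕ) : Matrix (MultiIndex d A) (MultiIndex d B) ℝ :=
  fun α β => l2Inner d (bernsteinPoly d A α) (bernsteinPoly d B β)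

/-- The Bernstein `L²` projection matrix `P^{N+M}_N`: the inverse mass matrix of degree `N`
times the matrix of inner products between the two Bernstein bases. -/
def bernsteinProj (d N M : ℕ) : Matrix (MultiIndex d N) (MultiIndex d (N + M)) ℝ :=
  (bernsteinGram d N N)⁻¹ * bernsteinGram d N (N + M)

/-- The one-degree elevation matrix `E^{K+1}_K`: its column `α` holds the coefficients in
`B^K_α = ∑_j (α_j + 1) / (K + 1) B^{K+1}_{α + e_j}`. -/
def elevOne (d K : ℕ) : Matrix (MultiIndex d (K + 1)) (MultiIndex d K) ℝ :=
  fun β α => ∑ j : Fin (d + 1),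
    if β.1 = α.1 + Pi.single j 1 then ((α.1 j : ℝ) + 1) / ((K : ℝ) + 1) else 0

/-- The degree elevation matrix `E^B_A = E^B_{B-1} E^{B-1}_{B-2} ⋯ E^{A+1}_A` for `A ≤ B`
(the identity if `A = B`; the value for `A > B` is irrelevant). -/
def elev (d A : ℕ) : (B : ℕ) → Matrix (MultiIndex d B) (MultiIndex d A) ℝ
  | 0 => fun β α => if β.1 = α.1 then 1 else 0
  | B + 1 =>
      if A ≤ B then elevOne d B * elev d A B
      else fun β α => if β.1 = α.1 then 1 else 0

/-- The nested matrix
`c₀ I + E^N_{N-1} (c₁ I + E^{N-1}_{N-2} (c₂ I + ⋯) (E^{N-1}_{N-2})ᵀ) (E^N_{N-1})ᵀ`. -/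
def telescope (d : ℕ) : (N : ℕ) → (ℕ → ℝ) → Matrix (MultiIndex d N) (MultiIndex d N) ℝ
  | 0, c => c 0 • 1
  | N + 1, c =>
      c 0 • 1 + elevOne d N * telescope d N (fun j => c (j + 1)) * (elevOne d N).transpose

/-- The product `(E^{N+1}_N)ᵀ (E^{N+2}_{N+1})ᵀ ⋯ (E^{N+M}_{N+M-1})ᵀ`. -/
def reduction (d N : ℕ) : (M : ℕ) → Matrix (MultiIndex d N) (MultiIndex d (N + M)) ℝ
  | 0 => 1
  | M + 1 => reduction d N M * (elevOne d (N + M)).transpose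

/-- The multiply-accumulate instruction `dst := dst + coef * src` on real registers with
addresses in `ρ`, where `coef` is a precomputed constant. -/
structure Instr (ρ : Type) where
  dst : ρ
  coef : ℝ
  src : ρ

/-- The memory after the execution of one instruction. -/
def Instr.exec {ρ : Type} [DecidableEq ρ] (s : ρ → ℝ) (i : Instr ρ) : ρ → ℝ :=
  Function.update s i.dst (s i.dst + i.coef * s i.src)

/-- The memory after the execution of a list of instructions, in order. -/
def runProgram {ρ : Type} [DecidableEq ρ] (prog : List (Instr ρ)) (s : ρ → ℝ) : ρ → ℝ :=
  prog.foldl Instr.exec s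

/-- The number of arithmetic operations: one multiplication and one addition per instruction. -/
def opCount {ρ : Type} (prog : List (Instr ρ)) : ℕ := 2 * prog.length

/-- Registers: `Sum.inl α` for the downward sweep, `Sum.inr α` for the upward sweep. -/
abbrev Reg (d : ℕ) : Type := (Fin (d + 1) → ℕ) ⊕ (Fin (d + 1) → ℕ)

/-- The downward sweep: for `K = L - 1, …, 0`, apply the sparse matrix `(E^{K+1}_K)ᵀ` to the
downward registers of order `K + 1`, with the result in those of order `K`. -/
def downSweep (d L : ℕ) : List (Instr (Reg d)) :=
  (List.range L).reverse.flatMap fun K =>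
    (List.Nat.antidiagonalTuple (d + 1) K).flatMap fun α =>
      (List.finRange (d + 1)).map fun j =>
        ⟨Sum.inl α, ((α j : ℝ) + 1) / ((K : ℝ) + 1), Sum.inl (α + Pi.single j 1)⟩

/-- The upward sweep: for `K = 0, …, N`, add to the upward registers of order `K` the downward
ones of order `K` scaled by `c_{N-K}`, and the sparse matrix `E^K_{K-1}` applied to the upward
registers of order `K - 1`. -/
def upSweep (d N : ℕ) (c : ℕ → ℝ) : List (Instr (Reg d)) :=
  (List.range (N + 1)).flatMap fun K =>
    (List.Nat.antidiagonalTuple (d + 1) K).flatMap fun α =>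
      ⟨Sum.inr α, c (N - K), Sum.inl α⟩ ::
        ((List.finRange (d + 1)).filter fun j => 0 < α j).map fun j =>
          ⟨Sum.inr α, (α j : ℝ) / (K : ℝ), Sum.inr (α - Pi.single j 1)⟩

/-- The projection algorithm that evaluates the telescoping form by sparse one-degree
reductions and elevations. -/
def projProgram (d N M : ℕ) (c : ℕ → ℝ) : List (Instr (Reg d)) :=
  downSweep d (N + M) ++ upSweep d N c

/-- Initial memory: the coefficients `v` in the downward registers of order `L`, zero elsewhere. -/
def loadInput (d L : ℕ) (v : MultiIndex d L → ℝ) : Reg d → ℝ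
  | Sum.inl α => if h : ∑ i, α i = L then v ⟨α, h⟩ else 0
  | Sum.inr _ => 0

/-- The output of the projection algorithm: the upward registers of order `N`. -/
def runProj (d N M : ℕ) (c : ℕ → ℝ) (v : MultiIndex d (N + M) → ℝ) : MultiIndex d N → ℝ :=
  fun α => runProgram (projProgram d N M c) (loadInput d (N + M) v) (Sum.inr α.1)

end

/-! Write `E` for one-degree elevation and `S_K` for `shiftMatrix d K`, whose entries move one unit
between slots of a multi-index. Both compositions of `E` with its transpose are expressed by it:
`(K+1)² E Eᵀ = S_{K+1}` on order `K + 1`, and `(K+1)² Eᵀ E = (2K+d+1) I + S_K` on order `K`. Hence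
`E` intertwines `S_K` and `S_{K+1}` up to a scalar shift (`shiftMatrix_mul_elev`), and `S_N` sends
`E^N_{K+1} (E^N_{K+1})ᵀ` to a combination of itself and `E^N_K (E^N_K)ᵀ`, the latter with nonzero
coefficient. Descending from `E^N_N = I`, every `E^N_K (E^N_K)ᵀ` is a polynomial in `S_N`. Their
span is therefore closed under products (`mul_mem_elevSpan`) and, being finite-dimensional, under
division by invertible elements (`inv_mul_mem_elevSpan`).

The Gram matrices are built from this span. Dirichlet's integral makes the entries of `G^{A,B}` a
constant times `∏ C(α_i+β_i, α_i)`. Vandermonde's identity in each slot, grouped by the order of the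
summation index, and the closed form of elevation entries (`choose_mul_elev`) turn this into a
positive combination of `E^A_K (E^B_K)ᵀ` (`bernsteinGram_eq`). As `E^B_K = E^B_A E^A_K`, the factor
`(E^B_A)ᵀ` splits off on the right. So `G^{N,N}` lies in the span, `G^{N,N+M}` is an element of the
span times `(E^{N+M}_N)ᵀ`, and the quotient has the claimed form.

Uniqueness is the solvability of the normal equations, since `G^{N,N}` is positive definite. The
algorithm is verified by an invariant for each sweep and counted instruction by instruction. -/

noncomputable section

/-! ### One-degree elevation as a sum over unit shifts -/

namespace MultiIndex

/-- The multi-index `α + e_j`. -/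
def inc {d K : ℕ} (α : MultiIndex d K) (j : Fin (d + 1)) : MultiIndex d (K + 1) :=
  ⟨α.1 + Pi.single j 1, by simp [Finset.sum_add_distrib, α.2]⟩

lemma sum_sub_single {d K : ℕ} (β : MultiIndex d (K + 1)) {j : Fin (d + 1)} (h : 0 < β.1 j) :
    ∑ i, (β.1 - Pi.single j 1 : Fin (d + 1) → ℕ) i = K := by
  have h1 : β.1 - Pi.single j 1 + Pi.single j 1 = β.1 := by
    funext i
    by_cases hi : i = j
    · subst hi; simp; omega
    · simp [hi]
  have h2 := β.2
  rw [← h1] at h2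
  simp only [Pi.add_apply, Finset.sum_add_distrib] at h2
  simpa using h2

end MultiIndex

lemma sum_elevOne_col {d K : ℕ} (α : MultiIndex d K) (f : MultiIndex d (K + 1) → ℝ) :
    ∑ β, elevOne d K β α * f β = ∑ j, ((α.1 j : ℝ) + 1) / (K + 1) * f (α.inc j) := by
  simp only [elevOne, Finset.sum_mul]
  rw [Finset.sum_comm]
  refine Finset.sum_congr rfl fun j _ => ?_
  rw [Finset.sum_eq_single (α.inc j)]
  · simp [MultiIndex.inc]
  · intro β _ hβ
    rw [if_neg, zero_mul]
    intro h
    exact hβ (Subtype.ext h)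
  · simp

lemma sum_elevOne_row {d K : ℕ} (β : MultiIndex d (K + 1)) (f : (Fin (d + 1) → ℕ) → ℝ) :
    ∑ α, elevOne d K β α * f α.1 = ∑ j, (β.1 j : ℝ) / (K + 1) * f (β.1 - Pi.single j 1) := by
  simp only [elevOne, Finset.sum_mul]
  rw [Finset.sum_comm]
  refine Finset.sum_congr rfl fun j _ => ?_
  -- For `β_j = 0` the truncated `β - e_j` is meaningless, but its coefficient is zero.
  rcases Nat.eq_zero_or_pos (β.1 j) with h | h
  · rw [h, Nat.cast_zero, zero_div, zero_mul]
    refine Finset.sum_eq_zero fun α _ => ?_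
    rw [if_neg, zero_mul]
    intro h'
    rw [h'] at h
    simp at h
  · have e : β.1 = (β.1 - Pi.single j 1 : Fin (d + 1) → ℕ) + Pi.single j 1 := by
      funext i
      by_cases hi : i = j
      · subst hi; simp; omega
      · simp [hi]
    rw [Finset.sum_eq_single (⟨β.1 - Pi.single j 1, β.sum_sub_single h⟩ : MultiIndex d K)]
    · rw [if_pos e]
      have : (((β.1 - Pi.single j 1 : Fin (d + 1) → ℕ) j : ℕ) : ℝ) + 1 = β.1 j := by
        rw [Pi.sub_apply, Pi.single_eq_same]
        norm_cast
        omega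
      rw [this]
    · intro α _ hα
      rw [if_neg, zero_mul]
      intro h'
      apply hα
      apply Subtype.ext
      simp [h']
    · simp

lemma elevOne_transpose_mulVec {d K : ℕ} (f : MultiIndex d (K + 1) → ℝ) (α : MultiIndex d K) :
    (elevOne d K).transpose.mulVec f α = ∑ j, ((α.1 j : ℝ) + 1) / (K + 1) * f (α.inc j) :=
  sum_elevOne_col α f

lemma elevOne_mulVec {d K : ℕ} (f : (Fin (d + 1) → ℕ) → ℝ) (β : MultiIndex d (K + 1)) :
    (elevOne d K).mulVec (fun α => f α.1) β =
      ∑ j, (β.1 j : ℝ) / (K + 1) * f (β.1 - Pi.single j 1) :=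
  sum_elevOne_row β f

/-! ### Ladder relations between elevation and its transpose -/

/-- The matrix with entries `α_i α'_j` at pairs `α' = α - e_i + e_j`. -/
def shiftMatrix (d K : ℕ) : Matrix (MultiIndex d K) (MultiIndex d K) ℝ :=
  fun α α' => ∑ i, ∑ j, (α.1 i : ℝ) *
    (if α'.1 = α.1 - Pi.single i 1 + Pi.single j 1 then
      (((α.1 - Pi.single i 1 : Fin (d + 1) → ℕ) j : ℕ) : ℝ) + 1 else 0)

lemma shiftMatrix_zero (d : ℕ) : shiftMatrix d 0 = 0 := by
  ext α α'
  have h : ∀ i, α.1 i = 0 := by simpa using α.2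
  simp [shiftMatrix, h]

lemma elevOne_mul_transpose (d K : ℕ) :
    ((K : ℝ) + 1) ^ 2 • (elevOne d K * (elevOne d K).transpose) = shiftMatrix d (K + 1) := by
  ext α α'
  have hK : (K : ℝ) + 1 ≠ 0 := by positivity
  have := sum_elevOne_row α (fun γ => ∑ j : Fin (d + 1),
    if α'.1 = γ + Pi.single j 1 then ((γ j : ℝ) + 1) / ((K : ℝ) + 1) else 0)
  simp only [Matrix.smul_apply, Matrix.mul_apply, Matrix.transpose_apply, smul_eq_mul]
  refine (congrArg (((K : ℝ) + 1) ^ 2 * ·) this).trans ?_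
  simp only [shiftMatrix, Finset.mul_sum]
  refine Finset.sum_congr rfl fun i _ => Finset.sum_congr rfl fun j _ => ?_
  split_ifs
  · field_simp
  · simp

/-- Adding a unit at `j` and then removing one at `i` agrees with the opposite order unless `i = j`.
There the weights are `(α_i + 1)²` and `α_i²`, and the differences `2α_i + 1` add up to `2K + d +
1`. -/
lemma transpose_mul_elevOne (d K : ℕ) :
    ((K : ℝ) + 1) ^ 2 • ((elevOne d K).transpose * elevOne d K) =
      (2 * (K : ℝ) + d + 1) • 1 + shiftMatrix d K := by
  ext α α'
  have hK : (K : ℝ) + 1 ≠ 0 := by positivity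
  have h1 := sum_elevOne_col α (fun β => elevOne d K β α')
  simp only [Matrix.smul_apply, Matrix.mul_apply, Matrix.transpose_apply, smul_eq_mul,
    Matrix.add_apply]
  rw [h1]
  have h2 : (2 * (K : ℝ) + d + 1) * (1 : Matrix (MultiIndex d K) (MultiIndex d K) ℝ) α α' =
      ∑ i : Fin (d + 1), ∑ j : Fin (d + 1),
        if i = j ∧ α = α' then 2 * (α.1 i : ℝ) + 1 else 0 := by
    by_cases h : α = α'
    · subst h
      simp only [Matrix.one_apply_eq, and_true, Finset.sum_ite_eq, Finset.mem_univ, if_true,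
        Finset.sum_add_distrib, ← Finset.mul_sum]
      have : ∑ i, (α.1 i : ℝ) = K := by exact_mod_cast α.2
      rw [this]
      simp
      ring
    · simp [h]
  rw [h2, shiftMatrix, ← Finset.sum_add_distrib]
  simp only [elevOne, Finset.mul_sum, ← Finset.sum_add_distrib]
  -- After the swap `i` is the slot that loses a unit and `j` the one that gains it, as in
  -- `shiftMatrix`.
  rw [Finset.sum_comm]
  refine Finset.sum_congr rfl fun i _ => Finset.sum_congr rfl fun j _ => ?_
  have lhs : ((K : ℝ) + 1) ^ 2 * (((α.1 j : ℝ) + 1) / (K + 1) *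
      (if (α.inc j).1 = α'.1 + Pi.single i 1 then ((α'.1 i : ℝ) + 1) / (K + 1) else 0)) =
      if α.1 + Pi.single j 1 = α'.1 + Pi.single i 1 then
        ((α.1 j : ℝ) + 1) * (α'.1 i + 1) else 0 := by
    by_cases e : α.1 + Pi.single j 1 = α'.1 + Pi.single i 1
    · rw [if_pos (show (α.inc j).1 = _ from e), if_pos e]
      field_simp
    · rw [if_neg (show ¬ (α.inc j).1 = _ from e), if_neg e]
      simp
  rw [lhs]
  by_cases hij : i = j
  · subst hij
    simp only [add_left_inj, true_and, Pi.sub_apply, Pi.single_eq_same]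
    by_cases h : α = α'
    · subst h
      rcases Nat.eq_zero_or_pos (α.1 i) with h0 | h0
      · simp [h0]
      · have e : α.1 = α.1 - Pi.single i 1 + Pi.single i 1 := by
          funext k
          by_cases hk : k = i
          · subst hk; simp; omega
          · simp [hk]
        rw [if_pos rfl, if_pos rfl, if_pos e]
        have : ((α.1 i - 1 : ℕ) : ℝ) + 1 = α.1 i := by norm_cast; omega
        rw [this]
        ring
    · have h' : ¬ α.1 = α'.1 := fun h' => h (Subtype.ext h')
      rw [if_neg h', if_neg h]
      rcases Nat.eq_zero_or_pos (α.1 i) with h0 | h0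
      · simp [h0]
      · rw [if_neg]
        · simp
        · intro e
          apply h'
          rw [e]
          funext k
          by_cases hk : k = i
          · subst hk; simp; omega
          · simp [hk]
  · have hji : j ≠ i := fun h => hij h.symm
    simp only [hij, false_and, if_false, zero_add]
    rcases Nat.eq_zero_or_pos (α.1 i) with h0 | h0
    · rw [if_neg]
      · simp [h0]
      · intro e
        have := congrFun e i
        simp [h0, hij] at this
    · by_cases e : α.1 + Pi.single j 1 = α'.1 + Pi.single i 1
      · have e' : α'.1 = α.1 - Pi.single i 1 + Pi.single j 1 := by
          funext k
          have := congrFun e k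
          by_cases hk : k = i
          · subst hk; simp [hij] at this ⊢; omega
          · simp [hk] at this ⊢; omega
        have ei := congrFun e i
        simp [hij] at ei
        rw [if_pos e, if_pos e', ei]
        simp [hji]
        ring
      · rw [if_neg e, if_neg]
        · simp
        · intro e'
          apply e
          rw [e']
          funext k
          by_cases hk : k = i
          · subst hk; simp [hij]; omega
          · simp [hk]

/-! ### Iterated elevation: entries and intertwining -/

lemma elev_self (d A : ℕ) : elev d A A = 1 := by
  cases A with
  | zero =>
    ext α β
    simp [elev, Matrix.one_apply, Subtype.ext_iff]
  | succ A =>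
    ext α β
    simp [elev, Matrix.one_apply, Subtype.ext_iff]

lemma elev_succ {d A B : ℕ} (h : A ≤ B) : elev d A (B + 1) = elevOne d B * elev d A B := by
  simp [elev, h]

lemma elev_mul_elev {d A B K : ℕ} (hKA : K ≤ A) (hAB : A ≤ B) :
    elev d A B * elev d K A = elev d K B := by
  induction B, hAB using Nat.le_induction with
  | base => rw [elev_self, Matrix.one_mul]
  | succ B hAB ih => rw [elev_succ hAB, Matrix.mul_assoc, ih, elev_succ (hKA.trans hAB)]

lemma elev_mul_elevOne {d K B : ℕ} (h : K + 1 ≤ B) :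
    elev d (K + 1) B * elevOne d K = elev d K B := by
  rw [← elev_mul_elev (Nat.le_succ K) h, elev_succ le_rfl, elev_self, Matrix.mul_one]

/-- This closed form lets products of binomials in the Gram matrix be read as products of elevation
matrices. -/
lemma choose_mul_elev {d K A : ℕ} (h : K ≤ A) (α : MultiIndex d A) (γ : MultiIndex d K) :
    (A.choose K : ℝ) * elev d K A α γ = ∏ i, ((α.1 i).choose (γ.1 i) : ℝ) := by
  induction A, h using Nat.le_induction with
  | base =>
    rw [elev_self, Nat.choose_self, Nat.cast_one, one_mul, Matrix.one_apply]
    split_ifs with e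
    · subst e; simp
    -- Distinct multi-indices of equal order cannot dominate one another, so some binomial vanishes.
    · obtain ⟨i, hi⟩ : ∃ i, α.1 i < γ.1 i := by
        by_contra! hc
        apply e
        have := (Finset.sum_eq_sum_iff_of_le (fun i _ => hc i)).1 (γ.2.trans α.2.symm)
        exact Subtype.ext (funext fun i => (this i (Finset.mem_univ i)).symm)
      symm
      exact Finset.prod_eq_zero (Finset.mem_univ i) (by simp [Nat.choose_eq_zero_of_lt hi])
  | succ A h ih =>
    have hA : (A : ℝ) + 1 ≠ 0 := by positivity
    have hc : (A.choose K : ℝ) ≠ 0 := by exact_mod_cast (Nat.choose_pos h).ne'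
    have hu : (A : ℝ) + 1 - K ≠ 0 := by
      have : (K : ℝ) ≤ A := by exact_mod_cast h
      linarith
    have hcc : ((A + 1).choose K : ℝ) * (A + 1 - K) = (A + 1) * A.choose K := by
      have := Nat.choose_mul_succ_eq A K
      have hs : ((A + 1 - K : ℕ) : ℝ) = (A : ℝ) + 1 - K := by
        push_cast [Nat.cast_sub (h.trans A.le_succ)]; ring
      rw [← hs]
      exact_mod_cast this.symm.trans (mul_comm _ _)
    rw [elev_succ h, Matrix.mul_apply]
    have key : ∀ x : MultiIndex d A, elev d K A x γ =
        (∏ i, ((x.1 i).choose (γ.1 i) : ℝ)) / A.choose K := by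
      intro x; rw [← ih x]; field_simp
    simp only [key]
    rw [sum_elevOne_row α (fun x => (∏ i, ((x i).choose (γ.1 i) : ℝ)) / A.choose K)]
    -- Absorption: `a C(a-1, g) = (a - g) C(a, g)` in slot `j`. The factors `α_j - γ_j` then sum to
    -- `A + 1 - K`.
    have term : ∀ j, (α.1 j : ℝ) *
        ∏ i, (((α.1 - Pi.single j 1 : Fin (d + 1) → ℕ) i).choose (γ.1 i) : ℝ) =
        ((α.1 j : ℝ) - γ.1 j) * ∏ i, ((α.1 i).choose (γ.1 i) : ℝ) := by
      intro j
      rw [← Finset.mul_prod_erase _ _ (Finset.mem_univ j),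
        ← Finset.mul_prod_erase _ (fun i => ((α.1 i).choose (γ.1 i) : ℝ)) (Finset.mem_univ j),
        ← mul_assoc, ← mul_assoc]
      congr 1
      · simp only [Pi.sub_apply, Pi.single_eq_same]
        cases hα : α.1 j with
        | zero =>
          cases γ.1 j <;> simp
        | succ a =>
          simp only [Nat.add_sub_cancel]
          rcases le_or_gt (γ.1 j) (a + 1) with hle | hlt
          · have := Nat.choose_mul_succ_eq a (γ.1 j)
            rw [← Nat.cast_sub hle]
            exact_mod_cast (mul_comm _ _).trans (this.trans (mul_comm _ _))
          · rw [Nat.choose_eq_zero_of_lt hlt, Nat.choose_eq_zero_of_lt (by omega)]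
            simp
      · refine Finset.prod_congr rfl fun i hi => ?_
        simp [Finset.ne_of_mem_erase hi]
    have total : ∑ j, ((α.1 j : ℝ) - γ.1 j) = A + 1 - K := by
      rw [Finset.sum_sub_distrib]
      have h1 : ∑ i, (α.1 i : ℝ) = ((A + 1 : ℕ) : ℝ) := by exact_mod_cast α.2
      have h2 : ∑ i, (γ.1 i : ℝ) = K := by exact_mod_cast γ.2
      rw [h1, h2]; push_cast; ring
    calc _ = ((A + 1).choose K : ℝ) * ∑ j, ((α.1 j : ℝ) - γ.1 j) *
          (∏ i, ((α.1 i).choose (γ.1 i) : ℝ)) / ((A + 1) * A.choose K) := by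
          congr 1
          refine Finset.sum_congr rfl fun j _ => ?_
          rw [← term]; field_simp
      _ = _ := by
          rw [← Finset.sum_div, ← Finset.sum_mul, total, ← hcc]
          have : ((A + 1).choose K : ℝ) ≠ 0 := by
            exact_mod_cast (Nat.choose_pos (h.trans A.le_succ)).ne'
          field_simp

/-- One step is `S_{N+1} E = (N+1)² E (Eᵀ E) = E ((2N+d+1) I + S_N)`; the scalars accumulate. -/
lemma shiftMatrix_mul_elev {d K N : ℕ} (h : K ≤ N) :
    ∃ s : ℝ, shiftMatrix d N * elev d K N = elev d K N * shiftMatrix d K + s • elev d K N := by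
  induction N, h using Nat.le_induction with
  | base => exact ⟨0, by simp [elev_self]⟩
  | succ N h ih =>
    obtain ⟨s, hs⟩ := ih
    refine ⟨2 * N + d + 1 + s, ?_⟩
    have e : shiftMatrix d (N + 1) * elevOne d N =
        elevOne d N * ((2 * (N : ℝ) + d + 1) • 1 + shiftMatrix d N) := by
      rw [← elevOne_mul_transpose, ← transpose_mul_elevOne]
      simp [Matrix.mul_assoc]
    rw [elev_succ h, ← Matrix.mul_assoc, e, Matrix.mul_assoc, Matrix.add_mul, hs]
    rw [Matrix.smul_mul, Matrix.one_mul, Matrix.mul_add, Matrix.mul_add, Matrix.mul_smul,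
      Matrix.mul_smul, Matrix.mul_assoc, add_smul (2 * (N : ℝ) + d + 1)]
    abel

/-! ### The algebra spanned by the products of elevations with their transposes -/

/-- The matrices `E^N_K (E^N_K)ᵀ`. -/
def elevSq (d N K : ℕ) : Matrix (MultiIndex d N) (MultiIndex d N) ℝ :=
  elev d K N * (elev d K N).transpose

/-- The span of the matrices `E^N_K (E^N_K)ᵀ` for `K ≤ N`. -/
def elevSpan (d N : ℕ) : Submodule ℝ (Matrix (MultiIndex d N) (MultiIndex d N) ℝ) :=
  Submodule.span ℝ (Set.range fun K : Fin (N + 1) => elevSq d N K)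

lemma elevSq_mem_elevSpan {d N K : ℕ} (h : K ≤ N) : elevSq d N K ∈ elevSpan d N :=
  Submodule.subset_span ⟨⟨K, by omega⟩, rfl⟩

lemma elevSq_self (d N : ℕ) : elevSq d N N = 1 := by simp [elevSq, elev_self]

lemma shiftMatrix_mul_elevSq_zero (d N : ℕ) :
    ∃ s : ℝ, shiftMatrix d N * elevSq d N 0 = s • elevSq d N 0 := by
  obtain ⟨s, hs⟩ := shiftMatrix_mul_elev (d := d) (Nat.zero_le N)
  refine ⟨s, ?_⟩
  rw [elevSq, ← Matrix.mul_assoc, hs, shiftMatrix_zero]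
  simp

/-- Moving `S` through `E^N_{K+1}` leaves `S_{K+1} = (K+1)² E Eᵀ` in the middle, which lowers the
inner order to `K`. -/
lemma shiftMatrix_mul_elevSq_succ {d N K : ℕ} (h : K + 1 ≤ N) :
    ∃ s : ℝ, shiftMatrix d N * elevSq d N (K + 1) =
      ((K : ℝ) + 1) ^ 2 • elevSq d N K + s • elevSq d N (K + 1) := by
  obtain ⟨s, hs⟩ := shiftMatrix_mul_elev (d := d) h
  refine ⟨s, ?_⟩
  simp only [elevSq]
  rw [← Matrix.mul_assoc, hs, ← elevOne_mul_transpose, ← elev_mul_elevOne h]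
  simp [Matrix.add_mul, Matrix.mul_assoc]

lemma shiftMatrix_mul_mem {d N : ℕ} {w : Matrix (MultiIndex d N) (MultiIndex d N) ℝ}
    (hw : w ∈ elevSpan d N) : shiftMatrix d N * w ∈ elevSpan d N := by
  induction hw using Submodule.span_induction with
  | mem x hx =>
    obtain ⟨⟨K, hK⟩, rfl⟩ := hx
    cases K with
    | zero =>
      obtain ⟨s, hs⟩ := shiftMatrix_mul_elevSq_zero d N
      exact hs ▸ Submodule.smul_mem _ _ (elevSq_mem_elevSpan (Nat.zero_le N))
    | succ K =>
      obtain ⟨s, hs⟩ := shiftMatrix_mul_elevSq_succ (d := d) (N := N) (K := K) (by omega)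
      exact hs ▸ Submodule.add_mem _
        (Submodule.smul_mem _ _ (elevSq_mem_elevSpan (by omega)))
        (Submodule.smul_mem _ _ (elevSq_mem_elevSpan (by omega)))
  | zero => simp
  | add x y _ _ hx hy => rw [Matrix.mul_add]; exact Submodule.add_mem _ hx hy
  | smul a x _ hx => rw [Matrix.mul_smul]; exact Submodule.smul_mem _ _ hx

/-- The three-term relation is solved for the lower order, so membership descends from `K = N`,
where the factor is the identity, using only stability under `S_N`. -/
lemma elevSq_mul_mem {d N K : ℕ} (h : K ≤ N) {w : Matrix (MultiIndex d N) (MultiIndex d N) ℝ}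
    (hw : w ∈ elevSpan d N) : elevSq d N K * w ∈ elevSpan d N := by
  induction h using Nat.decreasingInduction with
  | self => simpa [elevSq_self] using hw
  | of_succ K h ih =>
    obtain ⟨s, hs⟩ := shiftMatrix_mul_elevSq_succ (d := d) (N := N) (K := K) (by omega)
    have hK : ((K : ℝ) + 1) ^ 2 ≠ 0 := by positivity
    have e : elevSq d N K * w = (((K : ℝ) + 1) ^ 2)⁻¹ •
        (shiftMatrix d N * (elevSq d N (K + 1) * w) - s • (elevSq d N (K + 1) * w)) := by
      rw [← Matrix.mul_assoc, hs, Matrix.add_mul, Matrix.smul_mul, Matrix.smul_mul,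
        add_sub_cancel_right, smul_smul, inv_mul_cancel₀ hK, one_smul]
    rw [e]
    exact Submodule.smul_mem _ _ (Submodule.sub_mem _ (shiftMatrix_mul_mem ih)
      (Submodule.smul_mem _ _ ih))

lemma mul_mem_elevSpan {d N : ℕ} {u w : Matrix (MultiIndex d N) (MultiIndex d N) ℝ}
    (hu : u ∈ elevSpan d N) (hw : w ∈ elevSpan d N) : u * w ∈ elevSpan d N := by
  induction hu using Submodule.span_induction with
  | mem x hx =>
    obtain ⟨K, rfl⟩ := hx
    exact elevSq_mul_mem (by omega) hw
  | zero => simp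
  | add x y _ _ hx hy => rw [Matrix.add_mul]; exact Submodule.add_mem _ hx hy
  | smul a x _ hx => rw [Matrix.smul_mul]; exact Submodule.smul_mem _ _ hx

/-- Division by an invertible element stays in the span, which is finite-dimensional. -/
lemma inv_mul_mem_elevSpan {d N : ℕ} {u w : Matrix (MultiIndex d N) (MultiIndex d N) ℝ}
    (hu : u ∈ elevSpan d N) (hw : w ∈ elevSpan d N) (hdet : IsUnit u.det) :
    u⁻¹ * w ∈ elevSpan d N := by
  let f : elevSpan d N →ₗ[ℝ] elevSpan d N :=
    (LinearMap.mulLeft ℝ u).restrict fun x hx => mul_mem_elevSpan hu hx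
  have hf : Function.Injective f := by
    intro x y hxy
    have h : u * x.1 = u * y.1 := congrArg Subtype.val hxy
    apply Subtype.ext
    rw [← Matrix.nonsing_inv_mul_cancel_left u x.1 hdet, h,
      Matrix.nonsing_inv_mul_cancel_left u y.1 hdet]
  obtain ⟨x, hx⟩ := LinearMap.surjective_of_injective hf ⟨w, hw⟩
  have h : u * x.1 = w := congrArg Subtype.val hx
  rw [← h, Matrix.nonsing_inv_mul_cancel_left u x.1 hdet]
  exact x.2

lemma exists_coeff_of_mem_elevSpan {d N : ℕ} {u : Matrix (MultiIndex d N) (MultiIndex d N) ℝ}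
    (hu : u ∈ elevSpan d N) :
    ∃ c : ℕ → ℝ, u = ∑ j ∈ Finset.range (N + 1), c j • elevSq d N (N - j) := by
  obtain ⟨b, rfl⟩ := (Submodule.mem_span_range_iff_exists_fun ℝ).1 hu
  -- Coefficients are renumbered by `K = N - j`; the reduction modulo `N + 1` is harmless because `N
  -- - j ≤ N`.
  refine ⟨fun j => b (Fin.ofNat (N + 1) (N - j)), ?_⟩
  rw [← Finset.sum_range_reflect, ← Fin.sum_univ_eq_sum_range
    (fun j => b (Fin.ofNat (N + 1) (N - (N + 1 - 1 - j))) •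
      elevSq d N (N - (N + 1 - 1 - j)))]
  refine Finset.sum_congr rfl fun i _ => ?_
  have : N - (N + 1 - 1 - (i : ℕ)) = i := by omega
  rw [this]
  congr 2
  ext
  simp


/-! ### Dirichlet integrals on the simplex -/

open MeasureTheory in
lemma intervalIntegral_pow_mul_sub_pow (s : ℝ) (m n : ℕ) :
    ∫ t in (0 : ℝ)..s, t ^ m * (s - t) ^ n =
      s ^ (m + n + 1) * (m.factorial * n.factorial) / (m + n + 1).factorial := by
  induction m generalizing n with
  | zero =>
    simp only [pow_zero, one_mul, zero_add]
    rw [intervalIntegral.integral_comp_sub_left (fun x => x ^ n)]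
    simp [Nat.factorial_succ]
    field_simp
  | succ m ih =>
    -- This function vanishes at both ends, so integrating its derivative trades a power of `t` for
    -- one of `s - t`.
    have hd : ∀ t ∈ Set.uIcc 0 s, HasDerivAt (fun t : ℝ => t ^ (m + 1) * (s - t) ^ (n + 1))
        (((m : ℝ) + 1) * (t ^ m * (s - t) ^ (n + 1)) -
          ((n : ℝ) + 1) * (t ^ (m + 1) * (s - t) ^ n)) t := by
      intro t _
      convert! (hasDerivAt_pow (m + 1) t).mul
        (((hasDerivAt_const t s).sub (hasDerivAt_id t)).pow (n + 1)) using 1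
      simp
      ring
    have h := intervalIntegral.integral_eq_sub_of_hasDerivAt hd
      (Continuous.intervalIntegrable (by fun_prop) _ _)
    rw [intervalIntegral.integral_sub (Continuous.intervalIntegrable (by fun_prop) _ _)
      (Continuous.intervalIntegrable (by fun_prop) _ _), intervalIntegral.integral_const_mul,
      intervalIntegral.integral_const_mul, ih] at h
    simp only [sub_self, ne_eq, Nat.add_eq_zero_iff, one_ne_zero, and_false, not_false_eq_true,
      zero_pow, mul_zero, zero_mul] at h
    have hn : (n : ℝ) + 1 ≠ 0 := by positivity
    apply mul_left_cancel₀ hn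
    rw [← sub_eq_zero.1 h, show m + 1 + n + 1 = m + (n + 1) + 1 by ring,
      Nat.factorial_succ m, Nat.factorial_succ n]
    push_cast
    ring

/-- The simplex `{y ≥ 0, ∑ yᵢ ≤ s}`. -/
def cornerSimplex (d : ℕ) (s : ℝ) : Set (Fin d → ℝ) := {y | (∀ i, 0 ≤ y i) ∧ ∑ i, y i ≤ s}

lemma isCompact_cornerSimplex (d : ℕ) (s : ℝ) : IsCompact (cornerSimplex d s) := by
  have hc : IsClosed (cornerSimplex d s) := by
    have h1 : IsClosed {y : Fin d → ℝ | ∀ i, 0 ≤ y i} := by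
      simp only [Set.ofPred_forall]
      exact isClosed_iInter fun i => isClosed_le continuous_const (continuous_apply i)
    have h2 : IsClosed {y : Fin d → ℝ | ∑ i, y i ≤ s} := isClosed_le (by fun_prop) (by fun_prop)
    exact h1.inter h2
  refine (isCompact_univ_pi fun _ => isCompact_Icc (a := (0 : ℝ)) (b := s)).of_isClosed_subset hc ?_
  intro y hy i _
  exact ⟨hy.1 i, (Finset.single_le_sum (fun j _ => hy.1 j) (Finset.mem_univ i)).trans hy.2⟩

open MeasureTheory in
/-- Dirichlet's integral over the simplex `{y ≥ 0, ∑ yᵢ ≤ s}`. -/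
theorem setIntegral_cornerSimplex (d : ℕ) {s : ℝ} (hs : 0 ≤ s) (a : ℕ) (m : Fin d → ℕ) :
    ∫ y in cornerSimplex d s, (∏ i, y i ^ m i) * (s - ∑ i, y i) ^ a =
      s ^ (a + ∑ i, m i + d) * (a.factorial * ∏ i, ((m i).factorial : ℝ)) /
        (a + ∑ i, m i + d).factorial := by
  induction d generalizing s with
  | zero =>
    have h : cornerSimplex 0 s = Set.univ := by
      ext y; simp [cornerSimplex, hs]
    rw [h, Measure.restrict_univ, integral_unique]
    have : (a.factorial : ℝ) ≠ 0 := by positivity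
    have hv : (volume : Measure (Fin 0 → ℝ)).real Set.univ = 1 := by
      rw [Measure.volume_pi_eq_dirac]
      simp
    rw [hv]
    simp
    field_simp
  | succ d ih =>
    obtain ⟨F, hF⟩ : ∃ F : (Fin (d + 1) → ℝ) → ℝ,
      F = fun y => (∏ i, y i ^ m i) * (s - ∑ i, y i) ^ a := ⟨_, rfl⟩
    rw [← hF]
    have hmeas := (isCompact_cornerSimplex (d + 1) s).measurableSet
    have hint : Integrable ((cornerSimplex (d + 1) s).indicator F) volume := by
      rw [integrable_indicator_iff hmeas]
      exact ContinuousOn.integrableOn_compact (isCompact_cornerSimplex _ _)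
        (by rw [hF]; fun_prop)
    have he := (volume_preserving_piFinSuccAbove (fun _ : Fin (d + 1) => ℝ) 0).symm
    rw [← integral_indicator hmeas, ← he.integral_comp']
    have hint' := (he.integrable_comp_emb (MeasurableEquiv.measurableEmbedding _)).2 hint
    -- The slice at first coordinate `t` is a corner simplex of size `s - t`; this is why the size
    -- varies in the induction.
    have hslice : ∀ t : ℝ, ∫ y : Fin d → ℝ, (cornerSimplex (d + 1) s).indicator F
          ((MeasurableEquiv.piFinSuccAbove (fun _ : Fin (d + 1) => ℝ) 0).symm (t, y)) =
        (Set.Icc 0 s).indicator (fun t => (t ^ m 0 * (s - t) ^ (a + ∑ i : Fin d, m i.succ + d)) *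
          ((a.factorial * ∏ i : Fin d, ((m i.succ).factorial : ℝ)) /
            (a + ∑ i : Fin d, m i.succ + d).factorial)) t := by
      intro t
      have hcons : ∀ y : Fin d → ℝ,
          (MeasurableEquiv.piFinSuccAbove (fun _ : Fin (d + 1) => ℝ) 0).symm (t, y) =
            (Fin.cons t y : Fin (d + 1) → ℝ) := by
        intro y
        exact Fin.insertNth_zero' t y
      simp only [hcons]
      by_cases ht : t ∈ Set.Icc 0 s
      · rw [Set.indicator_of_mem ht]
        have hfun : (fun y : Fin d → ℝ =>
            (cornerSimplex (d + 1) s).indicator F (Fin.cons t y : Fin (d + 1) → ℝ)) =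
            (cornerSimplex d (s - t)).indicator fun y =>
              t ^ m 0 * ((∏ i, y i ^ m i.succ) * (s - t - ∑ i, y i) ^ a) := by
          funext y
          have hiff : (Fin.cons t y : Fin (d + 1) → ℝ) ∈ cornerSimplex (d + 1) s ↔
              y ∈ cornerSimplex d (s - t) := by
            simp only [cornerSimplex, Set.mem_ofPred_eq, Fin.forall_fin_succ, Fin.cons_zero,
              Fin.cons_succ, Fin.sum_univ_succ, ht.1, true_and, le_sub_iff_add_le']
          by_cases hy : y ∈ cornerSimplex d (s - t)
          · rw [Set.indicator_of_mem hy, Set.indicator_of_mem (hiff.2 hy), hF]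
            simp only [Fin.prod_univ_succ, Fin.sum_univ_succ, Fin.cons_zero, Fin.cons_succ]
            ring
          · rw [Set.indicator_of_notMem hy, Set.indicator_of_notMem (fun h => hy (hiff.1 h))]
        rw [hfun, integral_indicator (isCompact_cornerSimplex _ _).measurableSet,
          integral_const_mul, ih (sub_nonneg.2 ht.2)]
        ring
      · rw [Set.indicator_of_notMem ht]
        have hzero : ∀ y : Fin d → ℝ,
            (cornerSimplex (d + 1) s).indicator F (Fin.cons t y : Fin (d + 1) → ℝ) = 0 := by
          intro y
          apply Set.indicator_of_notMem
          intro hy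
          apply ht
          refine ⟨by simpa using hy.1 0, ?_⟩
          simpa using (Finset.single_le_sum (fun j _ => hy.1 j) (Finset.mem_univ 0)).trans hy.2
        simp [hzero]
    rw [Measure.volume_eq_prod] at hint' ⊢
    refine (integral_prod _ hint').trans ?_
    simp only [Function.comp, hslice]
    rw [integral_indicator measurableSet_Icc, integral_Icc_eq_integral_Ioc,
      ← intervalIntegral.integral_of_le hs, intervalIntegral.integral_mul_const,
      intervalIntegral_pow_mul_sub_pow, Fin.sum_univ_succ, Fin.prod_univ_succ]
    have e1 : a + (m 0 + ∑ i : Fin d, m i.succ) + (d + 1) =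
      m 0 + (a + ∑ i : Fin d, m i.succ + d) + 1 := by ring
    rw [e1]
    have h1 : ((a + ∑ i : Fin d, m i.succ + d).factorial : ℝ) ≠ 0 := by positivity
    field_simp

/-- The affine map `y ↦ 2y - 1` takes the corner simplex to the reference simplex. -/
lemma mem_refSimplex_iff {d : ℕ} (y : Fin d → ℝ) :
    (2 : ℝ) • y - 1 ∈ refSimplex d ↔ y ∈ cornerSimplex d 1 := by
  simp only [refSimplex, cornerSimplex, Set.mem_ofPred_eq, Pi.sub_apply, Pi.smul_apply,
    Pi.one_apply, smul_eq_mul, Finset.sum_sub_distrib, ← Finset.mul_sum]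
  refine and_congr (forall_congr' fun i => ?_) ?_
  · constructor <;> intro h <;> linarith
  · simp only [Finset.sum_const, Finset.card_univ, Fintype.card_fin, nsmul_eq_mul, mul_one]
    constructor <;> intro h <;> linarith

lemma isClosed_refSimplex (d : ℕ) : IsClosed (refSimplex d) := by
  have h1 : IsClosed {y : Fin d → ℝ | ∀ i, -1 ≤ y i} := by
    simp only [Set.ofPred_forall]
    exact isClosed_iInter fun i => isClosed_le continuous_const (continuous_apply i)
  have h2 : IsClosed {y : Fin d → ℝ | ∑ i, y i ≤ 2 - (d : ℝ)} :=
    isClosed_le (by fun_prop) (by fun_prop)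
  exact h1.inter h2

lemma refSimplex_eq_image (d : ℕ) :
    refSimplex d = (fun y : Fin d → ℝ => (2 : ℝ) • y - 1) '' cornerSimplex d 1 := by
  ext x
  constructor
  · intro hx
    have e : (2 : ℝ) • ((1 / 2 : ℝ) • (x + 1)) - 1 = x := by
      funext i; simp
    exact ⟨(1 / 2 : ℝ) • (x + 1), (mem_refSimplex_iff _).1 (e.symm ▸ hx), e⟩
  · rintro ⟨y, hy, rfl⟩
    exact (mem_refSimplex_iff y).2 hy

lemma isCompact_refSimplex (d : ℕ) : IsCompact (refSimplex d) := by
  rw [refSimplex_eq_image]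
  exact (isCompact_cornerSimplex d 1).image (by fun_prop)

open MeasureTheory in
lemma setIntegral_refSimplex {d : ℕ} (f : (Fin d → ℝ) → ℝ) :
    ∫ x in refSimplex d, f x = 2 ^ d * ∫ y in cornerSimplex d 1, f ((2 : ℝ) • y - 1) := by
  -- Translation by `1` reduces the affine change of variables to the scaling by `2`, with Jacobian
  -- `2 ^ d`.
  rw [← integral_indicator (isClosed_refSimplex d).measurableSet,
    ← integral_indicator (isCompact_cornerSimplex d 1).measurableSet,
    ← integral_sub_right_eq_self _ (1 : Fin d → ℝ)]
  have h := Measure.integral_comp_smul (volume : Measure (Fin d → ℝ))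
    (fun x => (refSimplex d).indicator f (x - 1)) 2
  have e : (fun y : Fin d → ℝ => (refSimplex d).indicator f ((2 : ℝ) • y - 1)) =
      (cornerSimplex d 1).indicator fun y => f ((2 : ℝ) • y - 1) := by
    funext y
    by_cases hy : y ∈ cornerSimplex d 1
    · rw [Set.indicator_of_mem hy, Set.indicator_of_mem ((mem_refSimplex_iff y).2 hy)]
    · rw [Set.indicator_of_notMem hy,
        Set.indicator_of_notMem fun h => hy ((mem_refSimplex_iff y).1 h)]
  rw [← e, h]
  simp

open MeasureTheory in
/-- The moments of the barycentric coordinates. -/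
theorem setIntegral_prod_baryCoord (d : ℕ) (m : Fin (d + 1) → ℕ) :
    ∫ x in refSimplex d, ∏ i, MvPolynomial.eval x (baryCoord d i) ^ m i =
      2 ^ d * (∏ i, ((m i).factorial : ℝ)) / (∑ i, m i + d).factorial := by
  rw [setIntegral_refSimplex]
  have e : ∀ y : Fin d → ℝ,
      ∏ i, MvPolynomial.eval ((2 : ℝ) • y - 1) (baryCoord d i) ^ m i =
        (∏ i : Fin d, y i ^ m i.succ) * (1 - ∑ i, y i) ^ m 0 := by
    intro y
    rw [Fin.prod_univ_succ, mul_comm]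
    congr 1
    · refine Finset.prod_congr rfl fun i _ => ?_
      simp [baryCoord]
    · simp [baryCoord, Finset.sum_sub_distrib, ← Finset.mul_sum]
      ring
  simp only [e]
  rw [setIntegral_cornerSimplex d zero_le_one, Fin.sum_univ_succ, Fin.prod_univ_succ]
  simp
  ring

/-! ### Gram matrices in terms of elevation -/

lemma l2Inner_bernsteinPoly {d A B : ℕ} (α : MultiIndex d A) (β : MultiIndex d B) :
    l2Inner d (bernsteinPoly d A α) (bernsteinPoly d B β) =
      2 ^ d * (A.factorial * B.factorial) / (A + B + d).factorial *
        ∏ i, ((α.1 i + β.1 i).choose (α.1 i) : ℝ) := by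
  have hm : ∀ {K : ℕ} (γ : MultiIndex d K),
      (Nat.multinomial Finset.univ γ.1 : ℝ) = K.factorial / ∏ i, ((γ.1 i).factorial : ℝ) := by
    intro K γ
    have h := Nat.multinomial_spec Finset.univ γ.1
    rw [γ.2] at h
    rw [← h]
    push_cast
    have : ∏ i, ((γ.1 i).factorial : ℝ) ≠ 0 := by positivity
    field_simp
  have e : ∀ x : Fin d → ℝ, MvPolynomial.eval x (bernsteinPoly d A α) *
      MvPolynomial.eval x (bernsteinPoly d B β) =
      ((Nat.multinomial Finset.univ α.1 : ℝ) * Nat.multinomial Finset.univ β.1) *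
        ∏ i, MvPolynomial.eval x (baryCoord d i) ^ (α.1 i + β.1 i) := by
    intro x
    simp only [bernsteinPoly, map_mul, MvPolynomial.eval_C, map_prod, map_pow, pow_add,
      Finset.prod_mul_distrib]
    ring
  simp only [l2Inner, e]
  rw [MeasureTheory.integral_const_mul, setIntegral_prod_baryCoord, hm, hm,
    Finset.sum_add_distrib, α.2, β.2]
  have hc : ∀ i, ((α.1 i + β.1 i).choose (α.1 i) : ℝ) =
      ((α.1 i + β.1 i).factorial : ℝ) / (((α.1 i).factorial : ℝ) * (β.1 i).factorial) := by
    intro i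
    rw [Nat.cast_add_choose]
  simp only [hc, Finset.prod_div_distrib, Finset.prod_mul_distrib]
  ring


/-- Vandermonde's identity in each slot, with the product of sums expanded and sorted by the order
of `γ`. -/
lemma prod_add_choose {d A B : ℕ} (α : MultiIndex d A) (β : MultiIndex d B) :
    ∏ i, ((α.1 i + β.1 i).choose (α.1 i) : ℝ) =
      ∑ K ∈ Finset.range (A + 1), ∑ γ : MultiIndex d K,
        (∏ i, ((α.1 i).choose (γ.1 i) : ℝ)) * ∏ i, ((β.1 i).choose (γ.1 i) : ℝ) := by
  have h1 : ∀ i, ((α.1 i + β.1 i).choose (α.1 i) : ℝ) =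
      ∑ k ∈ Finset.range (A + 1), ((α.1 i).choose k : ℝ) * (β.1 i).choose k := by
    intro i
    have hi : α.1 i ≤ A := by
      conv_rhs => rw [← α.2]
      exact Finset.single_le_sum (fun j _ => Nat.zero_le _) (Finset.mem_univ i)
    -- The natural range ends at `α_i`; terms up to `A` vanish, which gives a range common to all
    -- slots.
    rw [← Finset.sum_subset (Finset.range_mono (Nat.succ_le_succ hi))]
    · rw [add_comm (α.1 i) (β.1 i), Nat.add_choose_eq,
        Finset.Nat.sum_antidiagonal_eq_sum_range_succ_mk]
      push_cast
      refine Finset.sum_congr rfl fun k hk => ?_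
      rw [Nat.choose_symm (Finset.mem_range_succ_iff.1 hk), mul_comm]
    · intro k _ hk
      rw [Nat.choose_eq_zero_of_lt (by simpa using hk)]
      simp
  simp only [h1, ← Finset.prod_mul_distrib]
  rw [Finset.prod_univ_sum]
  set P := Fintype.piFinset fun _ : Fin (d + 1) => Finset.range (A + 1)
  -- A nonzero term forces `γ ≤ α` slotwise, hence order at most `A`.
  have h2 : ∑ γ ∈ P.filter (fun γ => ∑ i, γ i ∈ Finset.range (A + 1)),
      ∏ i, ((α.1 i).choose (γ i) : ℝ) * (β.1 i).choose (γ i) =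
      ∑ γ ∈ P, ∏ i, ((α.1 i).choose (γ i) : ℝ) * (β.1 i).choose (γ i) := by
    refine Finset.sum_filter_of_ne fun γ _ hγ => ?_
    rw [Finset.mem_range_succ_iff, ← α.2]
    refine Finset.sum_le_sum fun i _ => ?_
    by_contra! hlt
    apply hγ
    exact Finset.prod_eq_zero (Finset.mem_univ i) (by simp [Nat.choose_eq_zero_of_lt hlt])
  rw [← h2, ← Finset.sum_fiberwise_of_maps_to (t := Finset.range (A + 1))
    (g := fun γ : Fin (d + 1) → ℕ => ∑ i, γ i) (fun γ hγ => (Finset.mem_filter.1 hγ).2)]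
  refine Finset.sum_congr rfl fun K hK => ?_
  refine Finset.sum_subtype _ (fun γ => ?_) _
  simp only [Finset.mem_filter, P, Fintype.mem_piFinset]
  constructor
  · exact fun h => h.2
  · rintro rfl
    refine ⟨⟨fun i => ?_, hK⟩, rfl⟩
    rw [Finset.mem_range_succ_iff] at hK ⊢
    exact (Finset.single_le_sum (fun j _ => Nat.zero_le _) (Finset.mem_univ i)).trans hK

/-- The scalar factor of the Bernstein Gram matrix of degrees `A` and `B`. -/
def gramScale (d A B : ℕ) : ℝ :=
  2 ^ d * (A.factorial * B.factorial) / (A + B + d).factorial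

lemma gramScale_pos (d A B : ℕ) : 0 < gramScale d A B := by
  unfold gramScale; positivity

/-- The Gram matrices in terms of degree elevation. -/
theorem bernsteinGram_eq {d A B : ℕ} (h : A ≤ B) :
    bernsteinGram d A B = gramScale d A B • ∑ K ∈ Finset.range (A + 1),
      ((A.choose K : ℝ) * B.choose K) • (elevSq d A K * (elev d A B).transpose) := by
  ext α β
  rw [bernsteinGram, l2Inner_bernsteinPoly, prod_add_choose, Matrix.smul_apply, Matrix.sum_apply,
    smul_eq_mul, gramScale]
  congr 1
  refine Finset.sum_congr rfl fun K hK => ?_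
  have hK' := Finset.mem_range_succ_iff.1 hK
  rw [Matrix.smul_apply, elevSq, Matrix.mul_assoc, ← Matrix.transpose_mul,
    elev_mul_elev hK' h, Matrix.mul_apply, smul_eq_mul, Finset.mul_sum]
  refine Finset.sum_congr rfl fun γ _ => ?_
  rw [← choose_mul_elev hK', ← choose_mul_elev (hK'.trans h), Matrix.transpose_apply]
  ring

lemma bernsteinGram_self_eq (d N : ℕ) :
    bernsteinGram d N N = gramScale d N N • ∑ K ∈ Finset.range (N + 1),
      ((N.choose K : ℝ) * N.choose K) • elevSq d N K := by
  rw [bernsteinGram_eq le_rfl]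
  simp [elev_self]

lemma bernsteinGram_self_mem (d N : ℕ) : bernsteinGram d N N ∈ elevSpan d N := by
  rw [bernsteinGram_self_eq]
  exact Submodule.smul_mem _ _ (Submodule.sum_mem _ fun K hK => Submodule.smul_mem _ _
    (elevSq_mem_elevSpan (Finset.mem_range_succ_iff.1 hK)))

/-- The term `K = N` is the identity and the others are nonnegative multiples of matrices `E Eᵀ`. -/
lemma posDef_bernsteinGram (d N : ℕ) : (bernsteinGram d N N).PosDef := by
  rw [bernsteinGram_self_eq]
  refine Matrix.PosDef.smul ?_ (gramScale_pos d N N)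
  rw [Finset.sum_range_succ, add_comm, Nat.choose_self, elevSq_self, Nat.cast_one, one_mul,
    one_smul]
  refine Matrix.PosDef.one.add_posSemidef (Matrix.posSemidef_sum _ fun K _ => ?_)
  refine Matrix.PosSemidef.smul ?_ (by positivity)
  rw [elevSq, ← Matrix.conjTranspose_eq_transpose_of_trivial]
  exact Matrix.posSemidef_self_mul_conjTranspose _

lemma isUnit_det_bernsteinGram (d N : ℕ) : IsUnit (bernsteinGram d N N).det :=
  (Matrix.isUnit_iff_isUnit_det _).1 (posDef_bernsteinGram d N).isUnit

/-- The projection matrix is a combination of elevations after the reduction to degree `N`. -/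
theorem exists_bernsteinProj_eq (d N M : ℕ) :
    ∃ c : ℕ → ℝ, bernsteinProj d N M =
      (∑ j ∈ Finset.range (N + 1), c j • elevSq d N (N - j)) *
        (elev d N (N + M)).transpose := by
  obtain ⟨c, hc⟩ := exists_coeff_of_mem_elevSpan
    (inv_mul_mem_elevSpan (bernsteinGram_self_mem d N)
      (w := gramScale d N (N + M) • ∑ K ∈ Finset.range (N + 1),
        ((N.choose K : ℝ) * (N + M).choose K) • elevSq d N K)
      (Submodule.smul_mem _ _ (Submodule.sum_mem _ fun K hK => Submodule.smul_mem _ _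
        (elevSq_mem_elevSpan (Finset.mem_range_succ_iff.1 hK))))
      (isUnit_det_bernsteinGram d N))
  refine ⟨c, ?_⟩
  rw [← hc, bernsteinProj, bernsteinGram_eq (Nat.le_add_right N M), Matrix.mul_assoc,
    Matrix.smul_mul, Matrix.sum_mul]
  simp only [Matrix.smul_mul]

/-! ### Bernstein polynomials span the polynomials of bounded degree -/

/-- The span of the barycentric coordinates. -/
def barySpan (d : ℕ) : Submodule ℝ (MvPolynomial (Fin d) ℝ) :=
  Submodule.span ℝ (Set.range (baryCoord d))

lemma baryCoord_mem (d : ℕ) (i : Fin (d + 1)) : baryCoord d i ∈ barySpan d :=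
  Submodule.subset_span ⟨i, rfl⟩

lemma sum_baryCoord (d : ℕ) : ∑ i, baryCoord d i = 1 := by
  apply MvPolynomial.funext
  intro x
  simp [Fin.sum_univ_succ, baryCoord, ← Finset.mul_sum, Finset.sum_add_distrib]
  ring

lemma one_mem_barySpan (d : ℕ) : 1 ∈ barySpan d := by
  rw [← sum_baryCoord]
  exact Submodule.sum_mem _ fun i _ => baryCoord_mem d i

lemma X_mem_barySpan {d : ℕ} (i : Fin d) : MvPolynomial.X i ∈ barySpan d := by
  have e : (MvPolynomial.X i : MvPolynomial (Fin d) ℝ) = (2 : ℝ) • baryCoord d i.succ - 1 := by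
    apply MvPolynomial.funext
    intro x
    simp [baryCoord, MvPolynomial.smul_eval]
  rw [e]
  exact Submodule.sub_mem _ (Submodule.smul_mem _ _ (baryCoord_mem d _)) (one_mem_barySpan d)

/-- Since `1` is a combination of barycentric coordinates, the powers of the span increase, and
monomials of lower degree are also reached. -/
lemma mem_barySpan_pow {d N : ℕ} {p : MvPolynomial (Fin d) ℝ} (hp : p.totalDegree ≤ N) :
    p ∈ barySpan d ^ N := by
  have hone : (1 : Submodule ℝ (MvPolynomial (Fin d) ℝ)) ≤ barySpan d :=
    Submodule.one_le.2 (one_mem_barySpan d)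
  have hprod : ∀ (m : Fin d →₀ ℕ) (u : Finset (Fin d)),
      (∏ i ∈ u, MvPolynomial.X i ^ m i : MvPolynomial (Fin d) ℝ) ∈
        barySpan d ^ (∑ i ∈ u, m i) := by
    intro m u
    induction u using Finset.induction_on with
    | empty =>
      rw [Finset.prod_empty, Finset.sum_empty, pow_zero]
      exact Submodule.one_le.1 le_rfl
    | insert i u hi ih =>
      rw [Finset.prod_insert hi, Finset.sum_insert hi, pow_add]
      exact Submodule.mul_mem_mul (Submodule.pow_mem_pow _ (X_mem_barySpan i) _) ih
  rw [← p.support_sum_monomial_coeff]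
  refine Submodule.sum_mem _ fun m hm => ?_
  rw [MvPolynomial.monomial_eq, ← MvPolynomial.smul_eq_C_mul]
  exact Submodule.smul_mem _ _ (pow_right_mono₀ hone ((MvPolynomial.le_totalDegree hm).trans hp)
    (hprod m m.support))

lemma ofBernstein_add (d N : ℕ) (v w : MultiIndex d N → ℝ) :
    ofBernstein d N (v + w) = ofBernstein d N v + ofBernstein d N w := by
  simp [ofBernstein, add_mul, Finset.sum_add_distrib]

lemma ofBernstein_smul (d N : ℕ) (a : ℝ) (v : MultiIndex d N → ℝ) :
    ofBernstein d N (a • v) = a • ofBernstein d N v := by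
  simp [ofBernstein, Finset.smul_sum, MvPolynomial.smul_eq_C_mul, mul_assoc]

/-- The linear map from Bernstein coefficients to polynomials. -/
def ofBernsteinₗ (d N : ℕ) : (MultiIndex d N → ℝ) →ₗ[ℝ] MvPolynomial (Fin d) ℝ where
  toFun := ofBernstein d N
  map_add' := ofBernstein_add d N
  map_smul' := ofBernstein_smul d N

lemma bernsteinPoly_mem_range {d N : ℕ} (α : MultiIndex d N) :
    bernsteinPoly d N α ∈ LinearMap.range (ofBernsteinₗ d N) := by
  refine ⟨Pi.single α 1, ?_⟩
  change ofBernstein d N _ = _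
  rw [ofBernstein, Finset.sum_eq_single α]
  · simp
  · intro β _ h
    simp [h]
  · simp

lemma prod_baryCoord_mem_range {d N : ℕ} (α : MultiIndex d N) :
    ∏ i, baryCoord d i ^ α.1 i ∈ LinearMap.range (ofBernsteinₗ d N) := by
  have hm : (Nat.multinomial Finset.univ α.1 : ℝ) ≠ 0 := by
    exact_mod_cast (Nat.multinomial_pos _ _).ne'
  have e : ∏ i, baryCoord d i ^ α.1 i =
      (Nat.multinomial Finset.univ α.1 : ℝ)⁻¹ • bernsteinPoly d N α := by
    rw [bernsteinPoly, ← MvPolynomial.smul_eq_C_mul, smul_smul, inv_mul_cancel₀ hm, one_smul]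
  rw [e]
  exact Submodule.smul_mem _ _ (bernsteinPoly_mem_range α)

lemma barySpan_pow_le (d N : ℕ) : barySpan d ^ N ≤ LinearMap.range (ofBernsteinₗ d N) := by
  induction N with
  | zero =>
    rw [pow_zero, Submodule.one_le]
    have := prod_baryCoord_mem_range (⟨0, by simp⟩ : MultiIndex d 0)
    simpa using this
  | succ N ih =>
    rw [pow_succ', barySpan]
    refine Submodule.mul_le.2 fun p hp q hq => ?_
    obtain ⟨v, rfl⟩ := ih hq
    induction hp using Submodule.span_induction with
    | mem x hx =>
      obtain ⟨j, rfl⟩ := hx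
      change baryCoord d j * ofBernstein d N v ∈ _
      rw [ofBernstein, Finset.mul_sum]
      refine Submodule.sum_mem _ fun α _ => ?_
      have e : baryCoord d j * (MvPolynomial.C (v α) * bernsteinPoly d N α) =
          (v α * Nat.multinomial Finset.univ α.1) •
            ∏ i, baryCoord d i ^ (α.inc j).1 i := by
        have : ∏ i, baryCoord d i ^ (α.inc j).1 i =
            (∏ i, baryCoord d i ^ α.1 i) * baryCoord d j := by
          simp only [MultiIndex.inc, Pi.add_apply, pow_add, Finset.prod_mul_distrib,
            Pi.single_apply, pow_ite, pow_one, pow_zero, Finset.prod_ite_eq', Finset.mem_univ,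
            if_true]
        rw [this, bernsteinPoly, MvPolynomial.smul_eq_C_mul, map_mul]
        ring
      rw [e]
      exact Submodule.smul_mem _ _ (prod_baryCoord_mem_range _)
    | zero => simp
    | add x y _ _ hx hy => rw [add_mul]; exact Submodule.add_mem _ hx hy
    | smul a x _ hx => rw [smul_mul_assoc]; exact Submodule.smul_mem _ _ hx

/-- The Bernstein polynomials of degree `N` span the polynomials of degree at most `N`. -/
theorem exists_ofBernstein_eq {d N : ℕ} {p : MvPolynomial (Fin d) ℝ} (hp : p.totalDegree ≤ N) :
    ∃ v, ofBernstein d N v = p :=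
  barySpan_pow_le d N (mem_barySpan_pow hp)

lemma totalDegree_baryCoord_le (d : ℕ) (i : Fin (d + 1)) : (baryCoord d i).totalDegree ≤ 1 := by
  refine Fin.cases ?_ (fun j => ?_) i
  · refine (MvPolynomial.totalDegree_mul _ _).trans ?_
    rw [MvPolynomial.totalDegree_C, zero_add]
    refine (MvPolynomial.totalDegree_sub _ _).trans
      (max_le ((MvPolynomial.totalDegree_C _).le.trans zero_le_one) ?_)
    exact MvPolynomial.totalDegree_finsetSum_le fun j _ => (MvPolynomial.totalDegree_X j).le
  · refine (MvPolynomial.totalDegree_mul _ _).trans ?_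
    rw [MvPolynomial.totalDegree_C, zero_add]
    exact (MvPolynomial.totalDegree_add _ _).trans
      (max_le (by simp) (MvPolynomial.totalDegree_X j).le)

lemma totalDegree_ofBernstein_le (d N : ℕ) (v : MultiIndex d N → ℝ) :
    (ofBernstein d N v).totalDegree ≤ N := by
  refine MvPolynomial.totalDegree_finsetSum_le fun α _ => ?_
  refine (MvPolynomial.totalDegree_mul _ _).trans ?_
  rw [MvPolynomial.totalDegree_C, zero_add]
  refine (MvPolynomial.totalDegree_mul _ _).trans ?_
  rw [MvPolynomial.totalDegree_C, zero_add]
  refine (MvPolynomial.totalDegree_finsetProd _ _).trans ?_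
  conv_rhs => rw [← α.2]
  refine Finset.sum_le_sum fun i _ => (MvPolynomial.totalDegree_pow _ _).trans ?_
  simpa using Nat.mul_le_mul_left (α.1 i) (totalDegree_baryCoord_le d i)

/-! ### The projection through its normal equations -/

lemma l2Inner_comm (d : ℕ) (p q : MvPolynomial (Fin d) ℝ) : l2Inner d p q = l2Inner d q p := by
  simp only [l2Inner, mul_comm]

lemma l2Inner_ofBernstein_right {d N : ℕ} (p : MvPolynomial (Fin d) ℝ) (v : MultiIndex d N → ℝ) :
    l2Inner d p (ofBernstein d N v) = ∑ α, v α * l2Inner d p (bernsteinPoly d N α) := by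
  simp only [l2Inner, ofBernstein, map_sum, map_mul, MvPolynomial.eval_C, Finset.mul_sum]
  rw [MeasureTheory.integral_finsetSum]
  · refine Finset.sum_congr rfl fun α _ => ?_
    rw [← MeasureTheory.integral_const_mul]
    congr 1
    funext x
    ring
  · intro α _
    refine ContinuousOn.integrableOn_compact (isCompact_refSimplex d) (Continuous.continuousOn ?_)
    exact p.continuous_eval.mul
      (continuous_const.mul (bernsteinPoly d N α).continuous_eval)

lemma l2Inner_ofBernstein_bernsteinPoly {d A B : ℕ} (v : MultiIndex d B → ℝ)
    (α : MultiIndex d A) :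
    l2Inner d (ofBernstein d B v) (bernsteinPoly d A α) = (bernsteinGram d A B).mulVec v α := by
  rw [l2Inner_comm, l2Inner_ofBernstein_right]
  exact Finset.sum_congr rfl fun β _ => mul_comm _ _

lemma isL2Projection_ofBernstein_iff {d N L : ℕ} (v : MultiIndex d L → ℝ)
    (u : MultiIndex d N → ℝ) :
    IsL2Projection d N (ofBernstein d L v) (ofBernstein d N u) ↔
      (bernsteinGram d N N).mulVec u = (bernsteinGram d N L).mulVec v := by
  constructor
  · rintro ⟨-, h⟩
    funext α
    rw [← l2Inner_ofBernstein_bernsteinPoly, ← l2Inner_ofBernstein_bernsteinPoly]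
    obtain ⟨w, hw⟩ := bernsteinPoly_mem_range α
    rw [← hw]
    exact h _ (totalDegree_ofBernstein_le d N w)
  · intro h
    refine ⟨totalDegree_ofBernstein_le d N u, fun w hw => ?_⟩
    obtain ⟨w, rfl⟩ := exists_ofBernstein_eq hw
    simp only [l2Inner_ofBernstein_right, l2Inner_ofBernstein_bernsteinPoly, h]

/-- The Bernstein projection matrix is the only matrix of the `L²` projection. -/
theorem isL2ProjectionMatrix_iff {d N M : ℕ}
    (Q : Matrix (MultiIndex d N) (MultiIndex d (N + M)) ℝ) :
    IsL2ProjectionMatrix d N M Q ↔ Q = bernsteinProj d N M := by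
  have hdet := isUnit_det_bernsteinGram d N
  simp only [IsL2ProjectionMatrix, isL2Projection_ofBernstein_iff, Matrix.mulVec_mulVec]
  constructor
  · intro h
    have e : bernsteinGram d N N * Q = bernsteinGram d N (N + M) :=
      Matrix.mulVec_injective (funext h)
    rw [bernsteinProj, ← e, Matrix.nonsing_inv_mul_cancel_left _ _ hdet]
  · rintro rfl v
    rw [bernsteinProj, Matrix.mul_nonsing_inv_cancel_left _ _ hdet]


/-! ### Effect of one block of instructions -/

lemma runProgram_append {ρ : Type} [DecidableEq ρ] (l₁ l₂ : List (Instr ρ)) (s : ρ → ℝ) :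
    runProgram (l₁ ++ l₂) s = runProgram l₂ (runProgram l₁ s) := by
  simp [runProgram]

/-- Instructions that never read a register that one of them writes act independently. -/
lemma runProgram_apply_of_src_ne_dst {ρ : Type} [DecidableEq ρ] (l : List (Instr ρ)) (s : ρ → ℝ)
    (h : ∀ i ∈ l, ∀ j ∈ l, i.src ≠ j.dst) (r : ρ) :
    runProgram l s r = s r + (l.map fun i => if i.dst = r then i.coef * s i.src else 0).sum := by
  induction l generalizing s with
  | nil => simp [runProgram]
  | cons i l ih =>
    have hstep : runProgram (i :: l) s = runProgram l (Instr.exec s i) := rfl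
    rw [hstep, ih _ fun a ha b hb => h a (List.mem_cons_of_mem _ ha) b (List.mem_cons_of_mem _ hb),
      List.map_cons, List.sum_cons, ← add_assoc]
    congr 1
    · by_cases hr : i.dst = r
      · subst hr; simp [Instr.exec]
      · simp [Instr.exec, hr, Function.update_of_ne (Ne.symm hr)]
    · congr 1
      refine List.map_congr_left fun j hj => ?_
      have : j.src ≠ i.dst := h j (List.mem_cons_of_mem _ hj) i List.mem_cons_self
      simp [Instr.exec, Function.update_of_ne this]

lemma sum_map_flatMap {α β : Type*} (l : List α) (g : α → List β) (f : β → ℝ) :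
    ((l.flatMap g).map f).sum = (l.map fun a => ((g a).map f).sum).sum := by
  induction l with
  | nil => simp
  | cons a l ih => simp [ih]

lemma sum_map_filter {α : Type*} (l : List α) (p : α → Bool) (f : α → ℝ) :
    ((l.filter p).map f).sum = (l.map fun a => if p a then f a else 0).sum := by
  induction l with
  | nil => simp
  | cons a l ih => by_cases h : p a <;> simp [h, ih]

lemma sum_map_antidiagonalTuple {k n : ℕ} (α : Fin k → ℕ) (f : (Fin k → ℕ) → ℝ) :
    ((List.Nat.antidiagonalTuple k n).map fun β => if β = α then f β else 0).sum =
      if ∑ i, α i = n then f α else 0 := by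
  rw [← List.sum_toFinset _ (List.Nat.nodup_antidiagonalTuple k n), Finset.sum_ite_eq']
  simp [List.Nat.mem_antidiagonalTuple]

/-- The instructions of the downward sweep that compute the order `K`. -/
def downBlock (d K : ℕ) : List (Instr (Reg d)) :=
  (List.Nat.antidiagonalTuple (d + 1) K).flatMap fun α =>
    (List.finRange (d + 1)).map fun j =>
      ⟨Sum.inl α, ((α j : ℝ) + 1) / ((K : ℝ) + 1), Sum.inl (α + Pi.single j 1)⟩

/-- The instructions of the upward sweep that compute the order `K`. -/
def upBlock (d N : ℕ) (c : ℕ → ℝ) (K : ℕ) : List (Instr (Reg d)) :=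
  (List.Nat.antidiagonalTuple (d + 1) K).flatMap fun α =>
    ⟨Sum.inr α, c (N - K), Sum.inl α⟩ ::
      ((List.finRange (d + 1)).filter fun j => 0 < α j).map fun j =>
        ⟨Sum.inr α, (α j : ℝ) / (K : ℝ), Sum.inr (α - Pi.single j 1)⟩

lemma downSweep_eq (d L : ℕ) : downSweep d L = (List.range L).reverse.flatMap (downBlock d) := rfl

lemma downBlock_src_ne_dst (d K : ℕ) :
    ∀ i ∈ downBlock d K, ∀ j ∈ downBlock d K, i.src ≠ j.dst := by
  intro a ha b hb
  simp only [downBlock, List.mem_flatMap, List.mem_map, List.Nat.mem_antidiagonalTuple] at ha hb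
  obtain ⟨α, hα, j, -, rfl⟩ := ha
  obtain ⟨β, hβ, k, -, rfl⟩ := hb
  intro h
  have h' := Sum.inl.inj h
  rw [← h'] at hβ
  simp [Finset.sum_add_distrib, hα] at hβ

lemma runProgram_downBlock_inr {d K : ℕ} (s : Reg d → ℝ) (α : Fin (d + 1) → ℕ) :
    runProgram (downBlock d K) s (Sum.inr α) = s (Sum.inr α) := by
  rw [runProgram_apply_of_src_ne_dst _ _ (downBlock_src_ne_dst d K), downBlock, sum_map_flatMap]
  simp [Function.comp_def]

lemma runProgram_downBlock_inl {d K : ℕ} (s : Reg d → ℝ) (α : Fin (d + 1) → ℕ) :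
    runProgram (downBlock d K) s (Sum.inl α) = s (Sum.inl α) +
      if ∑ i, α i = K then
        ∑ j, ((α j : ℝ) + 1) / ((K : ℝ) + 1) * s (Sum.inl (α + Pi.single j 1)) else 0 := by
  rw [runProgram_apply_of_src_ne_dst _ _ (downBlock_src_ne_dst d K), downBlock, sum_map_flatMap]
  congr 1
  refine Eq.trans ?_ (sum_map_antidiagonalTuple α fun β =>
    ∑ j, ((β j : ℝ) + 1) / ((K : ℝ) + 1) * s (Sum.inl (β + Pi.single j 1)))
  congr 1
  refine List.map_congr_left fun β _ => ?_
  rw [Fin.sum_univ_def]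
  by_cases h : β = α
  · simp [h, Function.comp_def]
  · simp [h, Function.comp_def]

/-- Upward sources have order `K - 1` thanks to the filter `0 < α j`; without it the truncated `α -
e_j` would be the destination itself. -/
lemma upBlock_src_ne_dst (d N : ℕ) (c : ℕ → ℝ) (K : ℕ) :
    ∀ i ∈ upBlock d N c K, ∀ j ∈ upBlock d N c K, i.src ≠ j.dst := by
  have hdst : ∀ b ∈ upBlock d N c K, ∃ β : Fin (d + 1) → ℕ, ∑ i, β i = K ∧ b.dst = Sum.inr β := by
    intro b hb
    simp only [upBlock, List.mem_flatMap, List.mem_cons, List.mem_map, List.mem_filter,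
      List.Nat.mem_antidiagonalTuple] at hb
    obtain ⟨β, hβ, rfl | ⟨k, -, rfl⟩⟩ := hb
    · exact ⟨β, hβ, rfl⟩
    · exact ⟨β, hβ, rfl⟩
  intro a ha b hb
  obtain ⟨β, hβ, hb'⟩ := hdst b hb
  rw [hb']
  simp only [upBlock, List.mem_flatMap, List.mem_cons, List.mem_map, List.mem_filter,
    List.Nat.mem_antidiagonalTuple] at ha
  obtain ⟨α, hα, rfl | ⟨k, ⟨-, hk⟩, rfl⟩⟩ := ha
  · simp
  · intro h
    have hk' : 0 < α k := by simpa using hk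
    rw [← Sum.inr.inj h, ← hα] at hβ
    have hlt : ∑ i, (α - Pi.single k 1 : Fin (d + 1) → ℕ) i < ∑ i, α i :=
      Finset.sum_lt_sum (fun i _ => Nat.sub_le _ _) ⟨k, Finset.mem_univ k, by simp; omega⟩
    omega

lemma runProgram_upBlock_inl {d N K : ℕ} (c : ℕ → ℝ) (s : Reg d → ℝ) (α : Fin (d + 1) → ℕ) :
    runProgram (upBlock d N c K) s (Sum.inl α) = s (Sum.inl α) := by
  rw [runProgram_apply_of_src_ne_dst _ _ (upBlock_src_ne_dst d N c K), upBlock, sum_map_flatMap]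
  simp [Function.comp_def]

lemma runProgram_upBlock_inr {d N K : ℕ} (c : ℕ → ℝ) (s : Reg d → ℝ) (α : Fin (d + 1) → ℕ) :
    runProgram (upBlock d N c K) s (Sum.inr α) = s (Sum.inr α) +
      if ∑ i, α i = K then c (N - K) * s (Sum.inl α) +
        ∑ j, (α j : ℝ) / (K : ℝ) * s (Sum.inr (α - Pi.single j 1)) else 0 := by
  rw [runProgram_apply_of_src_ne_dst _ _ (upBlock_src_ne_dst d N c K), upBlock, sum_map_flatMap]
  congr 1
  refine Eq.trans ?_ (sum_map_antidiagonalTuple α fun β => c (N - K) * s (Sum.inl β) +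
    ∑ j, (β j : ℝ) / (K : ℝ) * s (Sum.inr (β - Pi.single j 1)))
  congr 1
  refine List.map_congr_left fun β _ => ?_
  rw [List.map_cons, List.sum_cons, List.map_map, sum_map_filter, Fin.sum_univ_def]
  by_cases h : β = α
  · subst h
    simp only [if_true, Function.comp_def]
    congr 2
    refine List.map_congr_left fun j _ => ?_
    -- The filtered-out indices return with coefficient zero.
    by_cases hj : 0 < β j
    · simp [hj]
    · simp [Nat.eq_zero_of_not_pos hj]
  · simp [h]

/-! ### Invariants of the two sweeps -/

/-- The memory when the orders `k, …, L` of the downward sweep have been computed. -/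
structure IsDownState (d L k : ℕ) (v : MultiIndex d L → ℝ) (s : Reg d → ℝ) : Prop where
  inr_eq : ∀ α, s (Sum.inr α) = 0
  inl_eq_zero : ∀ α : Fin (d + 1) → ℕ, ∑ i, α i < k → s (Sum.inl α) = 0
  inl_eq : ∀ K, k ≤ K → K ≤ L → ∀ α : MultiIndex d K,
    s (Sum.inl α.1) = (elev d K L).transpose.mulVec v α

lemma isDownState_loadInput (d L : ℕ) (v : MultiIndex d L → ℝ) :
    IsDownState d L L v (loadInput d L v) where
  inr_eq _ := rfl
  inl_eq_zero α h := by simp [loadInput, h.ne]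
  inl_eq K h₁ h₂ α := by
    obtain rfl := le_antisymm h₁ h₂
    simp [loadInput, α.2, elev_self]

lemma IsDownState.step {d L k : ℕ} {v : MultiIndex d L → ℝ} {s : Reg d → ℝ} (hk : k + 1 ≤ L)
    (h : IsDownState d L (k + 1) v s) : IsDownState d L k v (runProgram (downBlock d k) s) where
  inr_eq α := by rw [runProgram_downBlock_inr, h.inr_eq]
  inl_eq_zero α hα := by
    rw [runProgram_downBlock_inl, if_neg hα.ne, add_zero, h.inl_eq_zero α (by omega)]
  inl_eq K h₁ h₂ α := by
    rw [runProgram_downBlock_inl, α.2]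
    rcases h₁.eq_or_lt with rfl | hlt
    -- Instructions accumulate, so the target registers must still be zero.
    · rw [if_pos rfl, h.inl_eq_zero α.1 (by rw [α.2]; omega), zero_add,
        ← elev_mul_elevOne hk, Matrix.transpose_mul, ← Matrix.mulVec_mulVec,
        elevOne_transpose_mulVec]
      exact Finset.sum_congr rfl fun j _ => by rw [← h.inl_eq (k + 1) le_rfl hk (α.inc j)]; rfl
    · rw [if_neg hlt.ne', add_zero, h.inl_eq K hlt h₂]

lemma IsDownState.runProgram_downSweep {d L k : ℕ} {v : MultiIndex d L → ℝ} {s : Reg d → ℝ}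
    (hk : k ≤ L) (h : IsDownState d L k v s) :
    IsDownState d L 0 v (runProgram (downSweep d k) s) := by
  induction k generalizing s with
  | zero => simpa [downSweep, runProgram] using h
  | succ k ih =>
    rw [downSweep_eq, List.range_succ, List.reverse_append, List.flatMap_append,
      runProgram_append, ← downSweep_eq]
    refine ih (by omega) ?_
    simpa using h.step hk

/-- The memory when the orders below `k` of the upward sweep have been computed. -/
structure IsUpState (d N L k : ℕ) (c : ℕ → ℝ) (v : MultiIndex d L → ℝ) (s : Reg d → ℝ) :
    Prop where
  inl_eq : ∀ K, K ≤ L → ∀ α : MultiIndex d K,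
    s (Sum.inl α.1) = (elev d K L).transpose.mulVec v α
  inr_eq_zero : ∀ α : Fin (d + 1) → ℕ, k ≤ ∑ i, α i → s (Sum.inr α) = 0
  inr_eq : ∀ K, K < k → ∀ α : MultiIndex d K, s (Sum.inr α.1) =
    (telescope d K fun j => c (N - K + j)).mulVec ((elev d K L).transpose.mulVec v) α

lemma IsDownState.isUpState {d L : ℕ} {v : MultiIndex d L → ℝ} {s : Reg d → ℝ}
    (h : IsDownState d L 0 v s) (N : ℕ) (c : ℕ → ℝ) : IsUpState d N L 0 c v s where
  inl_eq K hK := h.inl_eq K (Nat.zero_le K) hK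
  inr_eq_zero α _ := h.inr_eq α
  inr_eq K hK := absurd hK (Nat.not_lt_zero K)

lemma IsUpState.step {d N L k : ℕ} {c : ℕ → ℝ} {v : MultiIndex d L → ℝ} {s : Reg d → ℝ}
    (hkN : k ≤ N) (hNL : N ≤ L) (h : IsUpState d N L k c v s) :
    IsUpState d N L (k + 1) c v (runProgram (upBlock d N c k) s) where
  inl_eq K hK α := by rw [runProgram_upBlock_inl, h.inl_eq K hK]
  inr_eq_zero α hα := by
    rw [runProgram_upBlock_inr, if_neg (by omega), add_zero, h.inr_eq_zero α (by omega)]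
  inr_eq K hK α := by
    rw [runProgram_upBlock_inr, α.2]
    rcases (Nat.lt_succ_iff.1 hK).eq_or_lt with rfl | hlt
    · rw [if_pos rfl, h.inr_eq_zero α.1 α.2.ge, zero_add, h.inl_eq K (hkN.trans hNL) α]
      cases K with
      | zero => simp [telescope, Matrix.smul_mulVec]
      | succ K =>
        -- The inner telescope drops the first scalar, which matches the list for order `K` because
        -- `K + 1 ≤ N`.
        have hc : (fun j => c (N - (K + 1) + (j + 1))) = fun j => c (N - K + j) := by
          funext j; congr 1; omega
        have hf : (fun β : MultiIndex d K => s (Sum.inr β.1)) =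
            (telescope d K fun j => c (N - K + j)).mulVec ((elev d K L).transpose.mulVec v) :=
          funext fun β => h.inr_eq K (Nat.lt_succ_self K) β
        have he := elevOne_mulVec (fun β => s (Sum.inr β)) α
        rw [hf] at he
        rw [telescope, hc, Matrix.add_mulVec, Matrix.smul_mulVec, Matrix.one_mulVec,
          ← Matrix.mulVec_mulVec, ← Matrix.mulVec_mulVec, Matrix.mulVec_mulVec v,
          ← Matrix.transpose_mul, elev_mul_elevOne (hkN.trans hNL), Pi.add_apply, he]
        simp
    · rw [if_neg hlt.ne, add_zero, h.inr_eq K hlt]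

lemma IsDownState.runProgram_upSweep {d N L : ℕ} {v : MultiIndex d L → ℝ} {s : Reg d → ℝ}
    (hNL : N ≤ L) (h : IsDownState d L 0 v s) (c : ℕ → ℝ) :
    IsUpState d N L (N + 1) c v (runProgram (upSweep d N c) s) := by
  suffices H : ∀ k ≤ N + 1,
      IsUpState d N L k c v (runProgram ((List.range k).flatMap (upBlock d N c)) s) from
    H (N + 1) le_rfl
  intro k
  induction k with
  | zero => intro _; simpa [runProgram] using h.isUpState N c
  | succ k ih =>
    intro hk
    rw [List.range_succ, List.flatMap_append, runProgram_append]
    simpa using (ih (by omega)).step (by omega) hNL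

/-- The algorithm evaluates the telescoping form. -/
theorem runProj_eq (d N M : ℕ) (c : ℕ → ℝ) (v : MultiIndex d (N + M) → ℝ) :
    runProj d N M c v = (telescope d N c * (elev d N (N + M)).transpose).mulVec v := by
  funext α
  have h := (((isDownState_loadInput d (N + M) v).runProgram_downSweep
    le_rfl).runProgram_upSweep (Nat.le_add_right N M) c).inr_eq N (Nat.lt_succ_self N) α
  rw [runProj, projProgram, runProgram_append, h, Matrix.mulVec_mulVec]
  simp

/-! ### Unfolding the telescope and counting operations -/

lemma reduction_eq (d N M : ℕ) : reduction d N M = (elev d N (N + M)).transpose := by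
  induction M with
  | zero => simp [reduction, elev_self]
  | succ M ih =>
    rw [reduction, ih, ← Matrix.transpose_mul, ← elev_succ (Nat.le_add_right N M)]
    rfl

lemma telescope_eq (d N : ℕ) (c : ℕ → ℝ) :
    telescope d N c = ∑ j ∈ Finset.range (N + 1), c j • elevSq d N (N - j) := by
  induction N generalizing c with
  | zero => simp [telescope, elevSq_self]
  | succ N ih =>
    rw [telescope, ih, Finset.sum_range_succ' _ (N + 1), Matrix.mul_sum, Matrix.sum_mul,
      add_comm (c 0 • 1), show elevSq d (N + 1) (N + 1 - 0) = 1 from elevSq_self d (N + 1)]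
    congr 1
    refine Finset.sum_congr rfl fun j _ => ?_
    rw [Nat.add_sub_add_right, elevSq, elevSq, elev_succ (Nat.sub_le N j), Matrix.transpose_mul]
    simp only [Matrix.mul_smul, Matrix.smul_mul, Matrix.mul_assoc]

/-- The first `k` entries lie in `{0, …, n}` and determine the last one. -/
lemma length_antidiagonalTuple_le (k n : ℕ) :
    (List.Nat.antidiagonalTuple (k + 1) n).length ≤ (n + 1) ^ k := by
  induction k generalizing n with
  | zero => simp
  | succ k ih =>
    rw [List.Nat.antidiagonalTuple, List.length_flatMap]
    refine (List.sum_le_card_nsmul _ ((n + 1) ^ k) ?_).trans ?_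
    · intro x hx
      obtain ⟨p, hp, rfl⟩ := List.mem_map.1 hx
      rw [List.length_map]
      refine (ih p.2).trans (Nat.pow_le_pow_left ?_ k)
      have := List.Nat.mem_antidiagonal.1 hp
      omega
    · simp [pow_succ, mul_comm]

lemma length_flatMap_le {α β : Type*} (l : List α) (g : α → List β) (n : ℕ)
    (h : ∀ a ∈ l, (g a).length ≤ n) : (l.flatMap g).length ≤ l.length * n := by
  rw [List.length_flatMap]
  refine (List.sum_le_card_nsmul _ n ?_).trans (by simp)
  intro x hx
  obtain ⟨a, ha, rfl⟩ := List.mem_map.1 hx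
  exact h a ha

lemma length_downSweep_le (d L : ℕ) : (downSweep d L).length ≤ L ^ (d + 1) * (d + 1) := by
  refine (length_flatMap_le _ _ (L ^ d * (d + 1)) fun K hK => ?_).trans ?_
  · refine (length_flatMap_le _ _ (d + 1) fun α _ => by simp).trans (Nat.mul_le_mul_right _ ?_)
    refine (length_antidiagonalTuple_le d K).trans (Nat.pow_le_pow_left ?_ d)
    simpa using hK
  · rw [List.length_reverse, List.length_range, pow_succ]
    exact le_of_eq (by ring)

lemma length_upSweep_le (d N : ℕ) (c : ℕ → ℝ) :
    (upSweep d N c).length ≤ (N + 1) ^ (d + 1) * (d + 2) := by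
  refine (length_flatMap_le _ _ ((N + 1) ^ d * (d + 2)) fun K hK => ?_).trans ?_
  · refine (length_flatMap_le _ _ (d + 2) fun α _ => ?_).trans (Nat.mul_le_mul_right _ ?_)
    · rw [List.length_cons, List.length_map]
      have := List.length_filter_le (fun j => decide (0 < α j)) (List.finRange (d + 1))
      rw [List.length_finRange] at this
      omega
    · refine (length_antidiagonalTuple_le d K).trans (Nat.pow_le_pow_left ?_ d)
      simpa using hK
  · rw [List.length_range, pow_succ]
    exact le_of_eq (by ring)

/-- For `N ≥ 1`, `N + M ≤ (M + 1) N` and `N + 1 ≤ 2 N` absorb the shifts into the constant. -/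
lemma opCount_projProgram_le (d M : ℕ) {N : ℕ} (hN : 1 ≤ N) (c : ℕ → ℝ) :
    opCount (projProgram d N M c) ≤
      2 * ((M + 1) ^ (d + 1) * (d + 1) + 2 ^ (d + 1) * (d + 2)) * N ^ (d + 1) := by
  have h1 : (N + M) ^ (d + 1) ≤ (M + 1) ^ (d + 1) * N ^ (d + 1) := by
    rw [← mul_pow]
    refine Nat.pow_le_pow_left ?_ _
    rw [add_one_mul, add_comm]
    exact Nat.add_le_add_right (Nat.le_mul_of_pos_right M hN) N
  have h2 : (N + 1) ^ (d + 1) ≤ 2 ^ (d + 1) * N ^ (d + 1) := by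
    rw [← mul_pow]
    exact Nat.pow_le_pow_left (by omega) _
  rw [opCount, projProgram, List.length_append]
  calc 2 * ((downSweep d (N + M)).length + (upSweep d N c).length)
      ≤ 2 * ((M + 1) ^ (d + 1) * N ^ (d + 1) * (d + 1) + 2 ^ (d + 1) * N ^ (d + 1) * (d + 2)) :=
        Nat.mul_le_mul_left _ (Nat.add_le_add
          ((length_downSweep_le d (N + M)).trans (Nat.mul_le_mul_right _ h1))
          ((length_upSweep_le d N c).trans (Nat.mul_le_mul_right _ h2)))
    _ = _ := by ring

end

theorem mainTheorem1 (d M : ℕ) :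
    ∃ C : ℝ, ∀ N : ℕ,
      (∀ Q : Matrix (MultiIndex d N) (MultiIndex d (N + M)) ℝ,
        IsL2ProjectionMatrix d N M Q ↔ Q = bernsteinProj d N M) ∧
      ∃ c : ℕ → ℝ,
        bernsteinProj d N M =
          ∑ j ∈ Finset.range (N + 1),
            c j • (elev d (N - j) N * (elev d (N - j) N).transpose *
              (elev d N (N + M)).transpose) ∧
        bernsteinProj d N M = telescope d N c * reduction d N M ∧
        (∀ v : MultiIndex d (N + M) → ℝ,
          runProj d N M c v = (bernsteinProj d N M).mulVec v) ∧
        (1 ≤ N → (opCount (projProgram d N M c) : ℝ) ≤ C * (N : ℝ) ^ (d + 1)) := by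
  refine ⟨((2 * ((M + 1) ^ (d + 1) * (d + 1) + 2 ^ (d + 1) * (d + 2)) : ℕ) : ℝ), fun N =>
    ⟨isL2ProjectionMatrix_iff, ?_⟩⟩
  obtain ⟨c, hc⟩ := exists_bernsteinProj_eq d N M
  have ht : bernsteinProj d N M = telescope d N c * (elev d N (N + M)).transpose := by
    rw [hc, telescope_eq]
  refine ⟨c, ?_, ?_, ?_, ?_⟩
  · rw [hc, Matrix.sum_mul]
    simp only [Matrix.smul_mul, elevSq]
  · rw [ht, reduction_eq]
  · intro v
    rw [runProj_eq, ht]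
  · intro hN
    exact_mod_cast opCount_projProgram_le d M hN c
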